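/- Fix a non-degenerate complete Boolean algebra $\mathcal A$ with least element $0$ and greatest element $1$. For $a\in\mathcal A$, let $p(a)$ be the set of families $(a_i)$ in $\mathcal A$ with $\bigvee a_i=a$ and $a_i\wedge a_j=0$ for $i\ne j$. A conditional set is a family $X=(X_a,\gamma_a)_{a\in\mathcal A}$ of sets $X_a$ and surjections $\gamma_a:X_1\to X_a$ such that $X_0$ is a singleton, $\gamma_1=\mathrm{id}$, $\gamma_b(x)=\gamma_b(y)$ implies $\gamma_a(x)=\gamma_a(y)$ for $a\le b$, and for all $(a_i)\in p(1)$ and $x_i\in X_{a_i}$ there is a unique $x=\sum a_ix_i\in X_1$ with $\gamma_{a_i}(x)=x_i$ for all $i$. For $a\le b$ and $x=\gamma_b(y)\in X_b$ write $ax=\gamma_a(y)$. A conditional subset $Y\sqsubseteq X$ living on $b\in\mathcal A$ consists of sets $Y_a\subseteq X_a$ ($a\le b$) that form, with the restrictions of the maps $x\mapsto ax$, a conditional set on the relative algebra $\{a:a\le b\}$. The one living on $0$ is denoted $\mathbf 0$. The conditional subsets of $X$, ordered by $\sqsubseteq$, form a complete Boolean algebra with joins $\sqcup$ and meets $\sqcap$.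 The conditional power set $P(X)$ is the conditional set for which $P(X)_a$ consists of the conditional subsets of $X$ living on some $b\le a$, with $\gamma_a(Y)=aY$ (if $Y$ lives on $b$, then $aY$ is $Y$ restricted to $a\wedge b$). A conditional function $f:X\to Y$ is a family of maps $f_a:X_a\to Y_a$ with $af_1(x)=f_a(ax)$ for all $a\in\mathcal A$, $x\in X_1$; the preimage $f^{-1}(V)$ of $V\sqsubseteq Y$ consists of the $x\in X_a$ with $f_a(x)\in V_a$. A conditional family $(Y^j)_{j\in J}$ in $P(X)$ is a conditional function $J\to P(X)$ on a conditional set $J$. The conditional natural numbers $\mathbf N$ are the conditional set of formal sums $\sum a_in_i$ with $n_i\in\{1,2,\dots\}$, with the conditional order generated by $\le$. A conditional topology on $X$ is a conditional subset $\mathcal T\sqsubseteq P(X)$ that contains $\mathbf 0$ and $X$ and is closed under finite conditional intersections and arbitrary conditional unions. The space $(X,\mathcal T)$ is conditionally compact if for every conditional family $(O^j)_{j\in J}$ in $\mathcal T$ with $X\sqsubseteq\sqcup_j O^j$ there are $n\in\mathbf N$ and a conditional family $(j_k)_{1\le k\le n}$ in $J$ with $X\sqsubseteq\sqcup_{1\le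 k\le n}O^{j_k}$. For a non-empty family $(X^i,\mathcal T^i)_{i\in I}$ of conditional topological spaces on $\mathcal A$, the conditional product $X=\prod_i X^i$ is the conditional set with $X_a=\prod_i X^i_a$ and the coordinatewise maps. The conditional product topology on $X$ is the conditional intersection of all conditional topologies that contain the stable hull (the set of all amalgamations) of $\{\pi_i^{-1}(O): i\in I,\ O\in\mathcal T^i\}$, where $\pi_i:X\to X^i$ are the projections. **Theorem (conditional Tychonoff).** Let $(X^i,\mathcal T^i)_{i\in I}$ be a non-empty family of conditional topological spaces on $\mathcal A$, and let $X=\prod_{i\in I} X^i$ carry the conditional product topology. Then $X$ is conditionally compact if and only if $X^i$ is conditionally compact for every $i\in I$. -/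

import Mathlib

universe u v w w'

/-- `(cᵢ) ∈ p(a)`: the family `c` is pairwise disjoint with supremum `a`
(entries equal to `⊥` are allowed). -/
def IsPartition {A : Type u} [CompleteBooleanAlgebra A] {ι : Type w} (c : ι → A) (a : A) : Prop :=
  (⨆ i, c i) = a ∧ ∀ i j, i ≠ j → c i ⊓ c j = ⊥

namespace IsPartition

variable {A : Type u} [CompleteBooleanAlgebra A]

theorem le {ι : Type w} {c : ι → A} {a : A} (h : IsPartition c a) (i : ι) : c i ≤ a :=
  h.1 ▸ le_iSup c i

theorem inf {ι : Type w} {c : ι → A} {a : A} (h : IsPartition c a) (b : A) :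
    IsPartition (fun i => b ⊓ c i) (b ⊓ a) := by
  refine ⟨by rw [← h.1, inf_iSup_eq], fun i j hij => ?_⟩
  rw [inf_inf_inf_comm, h.2 i j hij, inf_bot_eq]

theorem inf_of_le {ι : Type w} {c : ι → A} {a b : A} (h : IsPartition c a) (hb : b ≤ a) :
    IsPartition (fun i => b ⊓ c i) b := by
  have := h.inf b
  rwa [inf_eq_left.2 hb] at this

theorem option {ι : Type w} {c : ι → A} {a b : A} (h : IsPartition c a) (hb : a ≤ b) :
    IsPartition (fun o : Option ι => o.elim (b \ a) c) b := by
  refine ⟨?_, ?_⟩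
  · rw [iSup_option]
    simp only [Option.elim]
    rw [h.1, sdiff_sup_cancel hb]
  · have key : ∀ i, c i ⊓ (b \ a) = ⊥ := fun i =>
      le_bot_iff.1 ((inf_le_inf_right _ (h.le i)).trans (by rw [inf_sdiff_self_right]))
    rintro (_ | i) (_ | j) hij
    · exact absurd rfl hij
    · simpa [inf_comm] using key j
    · simpa using key i
    · exact h.2 i j fun e => hij (by rw [e])

/-- A partition indexed by any type can be reindexed by its nonzero members. -/
theorem range {ι : Type w} {c : ι → A} {a : A} (h : IsPartition c a) :
    IsPartition (fun b : {b : A // b ≠ ⊥ ∧ ∃ i, c i = b} => b.1) a := by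
  refine ⟨le_antisymm (iSup_le ?_) ?_, ?_⟩
  · rintro ⟨b, -, i, rfl⟩
    exact h.le i
  · rw [← h.1]
    refine iSup_le fun i => ?_
    by_cases hi : c i = ⊥
    · rw [hi]; exact bot_le
    · exact le_iSup (fun b : {b : A // b ≠ ⊥ ∧ ∃ i, c i = b} => b.1) ⟨c i, hi, i, rfl⟩
  · rintro ⟨b, hb, i, rfl⟩ ⟨b', hb', j, rfl⟩ hne
    exact h.2 i j fun e => hne (by subst e; rfl)

theorem self_compl (a : A) : IsPartition (fun t : ULift.{u} Bool => cond t.down a aᶜ) ⊤ := by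
  refine ⟨?_, ?_⟩
  · refine top_le_iff.1 ?_
    rw [← sup_compl_eq_top (x := a)]
    exact sup_le (le_iSup (fun t : ULift.{u} Bool => cond t.down a aᶜ) ⟨true⟩)
      (le_iSup (fun t : ULift.{u} Bool => cond t.down a aᶜ) ⟨false⟩)
  · rintro ⟨_ | _⟩ ⟨_ | _⟩ h <;> simp at h ⊢

/-- Every family has a disjoint refinement with the same supremum. -/
theorem exists_le {ι : Type w} (c : ι → A) :
    ∃ d : ι → A, IsPartition d (⨆ i, c i) ∧ ∀ i, d i ≤ c i := by
  let r : ι → ι → Prop := WellOrderingRel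
  have hw : WellFounded r := IsWellFounded.wf
  refine ⟨fun i => c i \ ⨆ j : {j // r j i}, c j.1, ⟨le_antisymm ?_ ?_, ?_⟩, fun i => sdiff_le⟩
  · exact iSup_mono fun i => sdiff_le
  · refine iSup_le fun i => ?_
    induction i using hw.induction with
    | _ i ih =>
      have h1 : c i ≤ (c i \ ⨆ j : {j // r j i}, c j.1) ⊔ ⨆ j : {j // r j i}, c j.1 := by
        rw [sdiff_sup_self]; exact le_sup_left
      exact h1.trans (sup_le (le_iSup (fun i => c i \ ⨆ j : {j // r j i}, c j.1) i)
        (iSup_le fun j => ih j.1 j.2))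
  · have key : ∀ i j, r i j →
        (c i \ ⨆ k : {k // r k i}, c k.1) ⊓ (c j \ ⨆ k : {k // r k j}, c k.1) = ⊥ := by
      intro i j hij
      refine le_bot_iff.1 ((inf_le_inf_right _ (sdiff_le.trans
        (le_iSup (fun k : {k // r k j} => c k.1) ⟨i, hij⟩))).trans ?_)
      rw [inf_sdiff_self_right]
    intro i j hij
    have h : ¬ r i j → ¬ r j i → i = j :=
      (inferInstance : Std.Trichotomous (WellOrderingRel : ι → ι → Prop)).trichotomous i j
    by_cases h1 : r i j
    · exact key i j h1
    · by_cases h2 : r j i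
      · rw [inf_comm]; exact key j i h2
      · exact absurd (h h1 h2) hij

end IsPartition

/-- A conditional set on the complete Boolean algebra `A`; `sec a` is the set `X_a`.
The index types of partitions range over the universe of `A`: this is no restriction, since the
nonzero members of a partition are distinct elements of `A` and `X_⊥` is a singleton. -/
structure CondSet (A : Type u) [CompleteBooleanAlgebra A] where
  sec : A → Type v
  γ : ∀ a, sec ⊤ → sec a
  nonempty_bot : Nonempty (sec ⊥)
  subsingleton_bot : Subsingleton (sec ⊥)
  surjective : ∀ a, Function.Surjective (γ a)
  identity : γ ⊤ = id
  consistency : ∀ a b x y, a ≤ b → γ b x = γ b y → γ a x = γ a y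
  stability : ∀ {ι : Type u} (c : ι → A), IsPartition c ⊤ → ∀ x : ∀ i, sec (c i),
    ∃! y : sec ⊤, ∀ i, γ (c i) y = x i

namespace CondSet

variable {A : Type u} [CompleteBooleanAlgebra A]

/-- The restriction `γ^a_b : X_a → X_b` for `b ≤ a`, characterised by `γ^a_b ∘ γ_a = γ_b`
(see `res_γ`). -/
noncomputable def res (X : CondSet.{u, v} A) {a b : A} (_h : b ≤ a) (x : X.sec a) : X.sec b :=
  X.γ b (Function.surjInv (X.surjective a) x)

section basic

variable (X : CondSet.{u, v} A)

theorem res_γ {a b : A} (h : b ≤ a) (x : X.sec ⊤) : X.res h (X.γ a x) = X.γ b x :=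
  X.consistency b a _ _ h (Function.surjInv_eq (X.surjective a) _)

theorem res_self {a : A} (h : a ≤ a) (x : X.sec a) : X.res h x = x :=
  Function.surjInv_eq (X.surjective a) x

theorem res_res {a b c : A} (h : b ≤ a) (h' : c ≤ b) (x : X.sec a) :
    X.res h' (X.res h x) = X.res (h'.trans h) x := by
  obtain ⟨x, rfl⟩ := X.surjective a x
  simp only [res_γ]

theorem res_top {a : A} (h : a ≤ ⊤) (x : X.sec ⊤) : X.res h x = X.γ a x := by
  conv_lhs => rw [← id_eq x, ← X.identity]
  exact X.res_γ h x

theorem nonempty_sec (a : A) : Nonempty (X.sec a) := by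
  obtain ⟨x⟩ := X.nonempty_bot
  obtain ⟨y, -⟩ := X.surjective ⊥ x
  exact ⟨X.γ a y⟩

theorem eq_of_res' {ι : Type u} {c : ι → A} {a : A} (h : IsPartition c a) {x y : X.sec a}
    (hxy : ∀ i, X.res (h.le i) x = X.res (h.le i) y) : x = y := by
  obtain ⟨z⟩ := X.nonempty_sec (⊤ \ a)
  have H := h.option (le_top : a ≤ ⊤)
  obtain ⟨x', hx'⟩ := X.surjective a x
  obtain ⟨y', hy'⟩ := X.surjective a y
  have ext' : ∀ t : X.sec a, ∃ s : X.sec ⊤, X.γ a s = t ∧ X.γ (⊤ \ a) s = z := by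
    intro t
    have H2 := (show IsPartition (fun _ : PUnit.{u + 1} => a) a from
      ⟨by simp, fun i j hij => absurd (Subsingleton.elim i j) hij⟩).option (le_top : a ≤ ⊤)
    obtain ⟨s, hs, -⟩ := X.stability _ H2 (fun o => match o with
      | none => z
      | some _ => t)
    exact ⟨s, hs (some ⟨⟩), hs none⟩
  obtain ⟨s, hs1, hs2⟩ := ext' x
  obtain ⟨t, ht1, ht2⟩ := ext' y
  have : s = t := by
    refine (X.stability _ H (fun o => X.γ _ s)).unique (fun _ => rfl) ?_
    rintro (_ | i)
    · exact ht2.trans hs2.symm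
    · have := hxy i
      rw [← hs1, ← ht1, res_γ, res_γ] at this
      exact this.symm
  rw [← hs1, ← ht1, this]

theorem exists_amalg' {ι : Type u} {c : ι → A} {a : A} (h : IsPartition c a)
    (x : ∀ i, X.sec (c i)) : ∃ y : X.sec a, ∀ i, X.res (h.le i) y = x i := by
  obtain ⟨z⟩ := X.nonempty_sec (⊤ \ a)
  obtain ⟨s, hs, -⟩ := X.stability _ (h.option (le_top : a ≤ ⊤)) (fun o => match o with
    | none => z
    | some i => x i)
  refine ⟨X.γ a s, fun i => ?_⟩
  rw [res_γ]
  exact hs (some i)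

end basic

end CondSet

/-- A conditional subset `Y` of `X`, living on the condition `dom`: sets `Y_a ⊆ X_a` for
`a ≤ dom` which, with the restrictions of the maps of `X`, form a conditional set on the relative
algebra of `dom` (consistency, identity and uniqueness of amalgamations are inherited from `X`).
By convention `sec a` is empty for `a` not below `dom`. -/
structure CondSubset {A : Type u} [CompleteBooleanAlgebra A] (X : CondSet.{u, v} A) where
  dom : A
  sec : ∀ a, Set (X.sec a)
  sec_eq_empty : ∀ a, ¬ a ≤ dom → sec a = ∅
  nonempty_bot : (sec ⊥).Nonempty
  image : ∀ a (h : a ≤ dom), X.res h '' sec dom = sec a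
  stable : ∀ {ι : Type u} (c : ι → A) (h : IsPartition c dom) (x : X.sec dom),
    (∀ i, X.res (h.le i) x ∈ sec (c i)) → x ∈ sec dom

namespace CondSubset

variable {A : Type u} [CompleteBooleanAlgebra A] {X : CondSet.{u, v} A}

theorem nonempty_iff (Y : CondSubset X) (a : A) : (Y.sec a).Nonempty ↔ a ≤ Y.dom := by
  constructor
  · intro h
    by_contra hn
    rw [Y.sec_eq_empty a hn] at h
    exact Set.not_nonempty_empty h
  · intro h
    rw [← Y.image a h, Set.image_nonempty]
    have := Y.nonempty_bot
    rwa [← Y.image ⊥ bot_le, Set.image_nonempty] at this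

theorem res_mem (Y : CondSubset X) {a b : A} (h : b ≤ a) {x : X.sec a} (hx : x ∈ Y.sec a) :
    X.res h x ∈ Y.sec b := by
  have ha := (Y.nonempty_iff a).1 ⟨x, hx⟩
  rw [← Y.image a ha] at hx
  obtain ⟨z, hz, rfl⟩ := hx
  rw [X.res_res, ← Y.image b (h.trans ha)]
  exact ⟨z, hz, rfl⟩

theorem glue (Y : CondSubset X) {a : A} {ι : Type u} {c : ι → A} (h : IsPartition c a)
    (x : X.sec a) (hx : ∀ i, X.res (h.le i) x ∈ Y.sec (c i)) : x ∈ Y.sec a := by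
  have ha : a ≤ Y.dom := by
    rw [← h.1]
    exact iSup_le fun i => (Y.nonempty_iff _).1 ⟨_, hx i⟩
  obtain ⟨z, hz⟩ := (Y.nonempty_iff Y.dom).2 le_rfl
  have H2 := (show IsPartition (fun _ : PUnit.{u + 1} => a) a from
      ⟨by simp, fun i j hij => absurd (Subsingleton.elim i j) hij⟩).option ha
  obtain ⟨s, hs⟩ := X.exists_amalg' H2 (fun o => match o with
      | none => X.res sdiff_le z
      | some _ => x)
  have hs1 : X.res ha s = x := hs (some ⟨⟩)
  rw [← Y.image a ha]
  refine ⟨s, Y.stable _ (h.option ha) s ?_, hs1⟩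
  rintro (_ | i)
  · have h2 : X.res sdiff_le s = X.res sdiff_le z := hs none
    exact h2 ▸ Y.res_mem sdiff_le hz
  · have := hx i
    rw [← hs1, X.res_res] at this
    exact this

theorem mem_bot (Y : CondSubset X) (x : X.sec ⊥) : x ∈ Y.sec ⊥ := by
  obtain ⟨y, hy⟩ := Y.nonempty_bot
  have := X.subsingleton_bot
  rwa [Subsingleton.elim x y]

theorem glue_any (Y : CondSubset X) {a : A} {ι : Type w} {c : ι → A} (h : IsPartition c a)
    (x : X.sec a) (hx : ∀ i, X.res (h.le i) x ∈ Y.sec (c i)) : x ∈ Y.sec a := by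
  refine Y.glue h.range x ?_
  rintro ⟨b, hb, i, rfl⟩
  exact hx i

theorem ext_sec {Y Z : CondSubset X} (h : ∀ a, Y.sec a = Z.sec a) : Y = Z := by
  have hd : Y.dom = Z.dom := le_antisymm
    ((Z.nonempty_iff _).1 (h _ ▸ (Y.nonempty_iff _).2 le_rfl))
    ((Y.nonempty_iff _).1 (h _ ▸ (Z.nonempty_iff _).2 le_rfl))
  have hs : Y.sec = Z.sec := funext h
  cases Y; cases Z
  cases hd; cases hs
  rfl

/-- The conditional subset with sections `s a`, for a family `s` that is closed under restriction
and under amalgamation. It lives on the largest `a` with `s a` nonempty. -/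
def ofSections (s : ∀ a, Set (X.sec a))
    (hres : ∀ {a b : A} (h : b ≤ a) (x : X.sec a), x ∈ s a → X.res h x ∈ s b)
    (hglue : ∀ {a : A} {ι : Type u} (c : ι → A) (h : IsPartition c a) (x : X.sec a),
      (∀ i, X.res (h.le i) x ∈ s (c i)) → x ∈ s a) : CondSubset X where
  dom := sSup {a | (s a).Nonempty}
  sec := s
  sec_eq_empty a ha := by
    by_contra hn
    exact ha (le_sSup (Set.nonempty_iff_ne_empty.2 hn))
  nonempty_bot := by
    obtain ⟨x⟩ := X.nonempty_bot
    exact ⟨x, hglue (fun i : PEmpty.{u + 1} => i.elim) ⟨by simp, fun i => i.elim⟩ x fun i => i.elim⟩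
  image a h := by
    refine Set.Subset.antisymm ?_ ?_
    · rintro _ ⟨x, hx, rfl⟩
      exact hres h x hx
    · intro y hy
      obtain ⟨d, hd, hle⟩ := IsPartition.exists_le
        (fun b : {b : A // (s b).Nonempty} => b.1)
      have hsup : (⨆ b : {b : A // (s b).Nonempty}, b.1) = sSup {a | (s a).Nonempty} :=
        (sSup_eq_iSup' _).symm
      rw [hsup] at hd
      have hex : ∀ b, ∃ z, z ∈ s (d b) := fun b =>
        b.2.elim fun z hz => ⟨_, hres (hle b) z hz⟩
      choose z hz using hex
      obtain ⟨t, ht⟩ := X.exists_amalg' hd z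
      have htm : t ∈ s _ := hglue d hd t fun i => by rw [ht]; exact hz i
      have H1 := (show IsPartition (fun _ : PUnit.{u + 1} => a) a from
        ⟨by simp, fun i j hij => absurd (Subsingleton.elim i j) hij⟩).option h
      obtain ⟨r, hr⟩ := X.exists_amalg' H1 (fun o => match o with
        | none => X.res sdiff_le t
        | some _ => y)
      refine ⟨r, hglue _ H1 r ?_, hr (some ⟨⟩)⟩
      rintro (_ | i)
      · rw [hr none]; exact hres _ t htm
      · rw [hr (some i)]; exact hy
  stable c h x hx := hglue c h x hx

/-- `Y ⊑ Z`. -/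
instance : PartialOrder (CondSubset X) where
  le Y Z := ∀ a, Y.sec a ⊆ Z.sec a
  le_refl _ _ := subset_rfl
  le_trans _ _ _ h h' a := (h a).trans (h' a)
  le_antisymm _ _ h h' := ext_sec fun a => (h a).antisymm (h' a)

/-- `X` as a conditional subset of itself. -/
def univ (X : CondSet.{u, v} A) : CondSubset X :=
  ofSections (fun _ => Set.univ) (fun _ _ _ => trivial) (fun _ _ _ _ => trivial)

/-- The conditional empty set `𝟎`, as the conditional subset of `X` that lives on `⊥`. -/
def empty (X : CondSet.{u, v} A) : CondSubset X :=
  ofSections (fun a => {_x | a = ⊥}) (fun h _ hx => le_bot_iff.1 (h.trans_eq hx))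
    (fun c h _ hx => by
      have hc : ∀ i, c i = ⊥ := hx
      exact h.1.symm.trans (by simp [hc]))

/-- The conditional union of a family: amalgamations `∑ bᵢ yᵢ` with `(bᵢ)` a partition and
`yᵢ` in the `bᵢ`-section of `Y i`. For the empty family it is `𝟎`. -/
def condUnion {κ : Type w} (Y : κ → CondSubset X) : CondSubset X :=
  ofSections
    (fun a => {x | ∃ (b : κ → A) (h : IsPartition b a), ∀ i, X.res (h.le i) x ∈ (Y i).sec (b i)})
    (by
      rintro a a' h x ⟨b, hb, hx⟩
      refine ⟨_, hb.inf_of_le h, fun i => ?_⟩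
      have := (Y i).res_mem (inf_le_right : a' ⊓ b i ≤ b i) (hx i)
      rw [X.res_res] at this ⊢
      exact this)
    (by
      intro a ι c h x hx
      choose b hb hm using hx
      have H : IsPartition (fun k => ⨆ i, b i k) a := by
        refine ⟨?_, fun k l hkl => ?_⟩
        · rw [iSup_comm, ← h.1]
          exact iSup_congr fun i => (hb i).1
        · rw [iSup_inf_iSup]
          refine le_bot_iff.1 (iSup_le ?_)
          rintro ⟨i, j⟩
          by_cases hij : i = j
          · subst hij
            exact ((hb i).2 k l hkl).le
          · exact (inf_le_inf ((hb i).le k) ((hb j).le l)).trans (h.2 i j hij).le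
      refine ⟨_, H, fun k => ?_⟩
      have Hk : IsPartition (fun i => b i k) (⨆ i, b i k) := ⟨rfl, fun i j hij =>
        le_bot_iff.1 ((inf_le_inf ((hb i).le k) ((hb j).le k)).trans (h.2 i j hij).le)⟩
      refine (Y k).glue Hk _ fun i => ?_
      have := hm i k
      rw [X.res_res] at this ⊢
      exact this)

/-- The conditional intersection of a family. It lives on the largest `a` for which the sets
`(Y i).sec a` have a common element. For the empty family it is `X`. -/
def condInter {κ : Type w} (Y : κ → CondSubset X) : CondSubset X :=
  ofSections (fun a => {x | ∀ i, x ∈ (Y i).sec a})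
    (fun h _ hx i => (Y i).res_mem h (hx i))
    (fun _ h x hx i => (Y i).glue h x fun j => hx j i)

/-- `⊔ Y i` is the least upper bound for conditional inclusion. -/
theorem isLUB_condUnion {κ : Type w} (Y : κ → CondSubset X) :
    IsLUB (Set.range Y) (condUnion Y) := by
  classical
  refine ⟨?_, ?_⟩
  · rintro _ ⟨k, rfl⟩ a x hx
    have H : IsPartition (fun i => if i = k then a else ⊥) a := by
      refine ⟨le_antisymm (iSup_le fun i => ?_) (le_iSup_of_le k (by simp)), fun i j hij => ?_⟩
      · show (if i = k then a else ⊥) ≤ a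
        split_ifs
        exacts [le_rfl, bot_le]
      by_cases hi : i = k
      · subst hi
        simp [Ne.symm hij]
      · simp [hi]
    refine ⟨_, H, fun i => ?_⟩
    by_cases hi : i = k
    · subst hi
      exact (Y i).res_mem _ hx
    · have aux : ∀ (b : A) (hb : b ≤ a), b = ⊥ → X.res hb x ∈ (Y i).sec b := by
        rintro _ hb rfl
        exact (Y i).mem_bot _
      exact aux _ _ (if_neg hi)
  · rintro Z hZ a x ⟨b, hb, hx⟩
    exact Z.glue_any hb x fun i => hZ ⟨i, rfl⟩ _ (hx i)

/-- `⊓ Y i` is the greatest lower bound for conditional inclusion. -/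
theorem isGLB_condInter {κ : Type w} (Y : κ → CondSubset X) :
    IsGLB (Set.range Y) (condInter Y) := by
  refine ⟨?_, ?_⟩
  · rintro _ ⟨k, rfl⟩ a x hx
    exact hx k
  · intro Z hZ a x hx i
    exact hZ ⟨i, rfl⟩ a hx

/-- The stable hull `cond(G)` of a set `G ⊆ X_⊤`: all amalgamations `∑ cᵢ (cᵢ xᵢ)`, `xᵢ ∈ G`
(and `𝟎` if `G` is empty). -/
def stableHull (G : Set (X.sec ⊤)) : CondSubset X :=
  ofSections
    (fun a => {x | ∃ (ι : Type u) (c : ι → A) (h : IsPartition c a),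
      ∀ i, ∃ y ∈ G, X.res (h.le i) x = X.γ (c i) y})
    (by
      rintro a b h x ⟨ι, c, hc, hx⟩
      refine ⟨ι, _, hc.inf_of_le h, fun i => ?_⟩
      obtain ⟨y, hy, hxy⟩ := hx i
      refine ⟨y, hy, ?_⟩
      have := congrArg (X.res (inf_le_right : b ⊓ c i ≤ c i)) hxy
      rw [X.res_res, X.res_γ] at this
      rw [X.res_res]
      exact this)
    (by
      intro a ι c h x hx
      choose κ d hd hm using hx
      have H : IsPartition (fun p : Σ i, κ i => d p.1 p.2) a := by
        refine ⟨?_, ?_⟩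
        · rw [iSup_sigma, ← h.1]
          exact iSup_congr fun i => (hd i).1
        · rintro ⟨i, k⟩ ⟨j, l⟩ hne
          by_cases hij : i = j
          · subst hij
            exact (hd i).2 k l fun e => hne (by rw [e])
          · exact le_bot_iff.1 ((inf_le_inf ((hd i).le k) ((hd j).le l)).trans (h.2 i j hij).le)
      refine ⟨_, _, H, ?_⟩
      rintro ⟨i, k⟩
      obtain ⟨y, hy, hxy⟩ := hm i k
      rw [X.res_res] at hxy
      exact ⟨y, hy, hxy⟩)

/-- `aY`, the restriction of `Y` to the condition `a`; it lives on `a ⊓ Y.dom`. -/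
def restrict (a : A) (Y : CondSubset X) : CondSubset X :=
  ofSections (fun c => {x | c ≤ a ∧ x ∈ Y.sec c})
    (fun h _ hx => ⟨h.trans hx.1, Y.res_mem h hx.2⟩)
    (fun c h x hx => ⟨by rw [← h.1]; exact iSup_le fun i => (hx i).1,
      Y.glue h x fun i => (hx i).2⟩)

theorem restrict_dom (a : A) (Y : CondSubset X) : (restrict a Y).dom = a ⊓ Y.dom := by
  refine le_antisymm ?_ ?_
  · obtain ⟨x, hx⟩ := ((restrict a Y).nonempty_iff _).2 le_rfl
    exact le_inf hx.1 ((Y.nonempty_iff _).1 ⟨x, hx.2⟩)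
  · obtain ⟨x, hx⟩ := (Y.nonempty_iff (a ⊓ Y.dom)).2 inf_le_right
    exact ((restrict a Y).nonempty_iff _).1 ⟨x, inf_le_left, hx⟩

theorem restrict_eq_self {a : A} {Y : CondSubset X} (h : Y.dom ≤ a) : restrict a Y = Y :=
  ext_sec fun c => Set.ext fun x =>
    ⟨fun hx => hx.2, fun hx => ⟨((Y.nonempty_iff c).1 ⟨x, hx⟩).trans h, hx⟩⟩

theorem restrict_restrict {a b : A} (h : a ≤ b) (Y : CondSubset X) :
    restrict a (restrict b Y) = restrict a Y :=
  ext_sec fun _ => Set.ext fun _ =>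
    ⟨fun hx => ⟨hx.1, hx.2.2⟩, fun hx => ⟨hx.1, hx.1.trans h, hx.2⟩⟩

/-- A conditional subset that lives on `⊤`, regarded as a conditional set on `A`. -/
def toCondSet (Y : CondSubset X) (hY : Y.dom = ⊤) : CondSet.{u, v} A where
  sec a := Y.sec a
  γ a x := ⟨X.γ a x.1, X.res_top le_top x.1 ▸ Y.res_mem le_top x.2⟩
  nonempty_bot := Y.nonempty_bot.to_subtype
  subsingleton_bot := ⟨fun x y => Subtype.ext (X.subsingleton_bot.elim _ _)⟩
  surjective a := by
    rintro ⟨y, hy⟩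
    obtain ⟨z, hz, rfl⟩ := (Y.image a (hY ▸ le_top)).symm ▸ hy
    have : ∀ (d : A) (hd : d = ⊤) (h : a ≤ d) (z : X.sec d), z ∈ Y.sec d →
        ∃ t ∈ Y.sec ⊤, X.γ a t = X.res h z := by
      rintro _ rfl h z hz
      exact ⟨z, hz, (X.res_top h z).symm⟩
    obtain ⟨t, ht, e⟩ := this _ hY (hY ▸ le_top) z hz
    exact ⟨⟨t, ht⟩, Subtype.ext e⟩
  identity := funext fun x => Subtype.ext (congrFun X.identity x.1)
  consistency a b x y h e := Subtype.ext (X.consistency a b _ _ h (congrArg Subtype.val e))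
  stability c h x := by
    obtain ⟨y, hy, huniq⟩ := X.stability c h fun i => (x i).1
    refine ⟨⟨y, Y.glue h y fun i => ?_⟩, fun i => Subtype.ext (hy i), fun z hz =>
      Subtype.ext (huniq z.1 fun i => congrArg Subtype.val (hz i))⟩
    rw [X.res_top, hy]
    exact (x i).2

end CondSubset

namespace CondSet

variable {A : Type u} [CompleteBooleanAlgebra A]

/-- The conditional power set `P(X)`: `P(X)_a` consists of the conditional subsets of `X` living
on a condition below `a`, and `P(X)_⊤ → P(X)_a` is `Y ↦ aY`. -/
def powerset (X : CondSet.{u, v} A) : CondSet.{u, max u v} A where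
  sec a := {Y : CondSubset X // Y.dom ≤ a}
  γ a Y := ⟨CondSubset.restrict a Y.1, by rw [CondSubset.restrict_dom]; exact inf_le_left⟩
  nonempty_bot := ⟨⟨CondSubset.restrict ⊥ (CondSubset.univ X), by
    rw [CondSubset.restrict_dom]; exact inf_le_left⟩⟩
  subsingleton_bot := by
    refine ⟨fun Y Z => Subtype.ext ?_⟩
    have key : ∀ Y Z : CondSubset X, Y.dom ≤ ⊥ → Y ≤ Z := by
      intro Y Z h a x hx
      have ha : a = ⊥ := le_bot_iff.1 (((Y.nonempty_iff a).1 ⟨x, hx⟩).trans h)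
      subst ha
      exact Z.mem_bot x
    exact le_antisymm (key _ _ Y.2) (key _ _ Z.2)
  surjective a := fun Y =>
    ⟨⟨Y.1, le_top⟩, Subtype.ext (CondSubset.restrict_eq_self Y.2)⟩
  identity := funext fun Y => Subtype.ext (CondSubset.restrict_eq_self Y.2)
  consistency a b Y Z h e := by
    have e' := congrArg (fun W => CondSubset.restrict a W.1) e
    simp only [CondSubset.restrict_restrict h] at e'
    exact Subtype.ext e'
  stability {ι} c h Y := by
    let W : CondSubset X := CondSubset.ofSections
      (fun a => {x | ∀ i, X.res (inf_le_left : a ⊓ c i ≤ a) x ∈ (Y i).1.sec (a ⊓ c i)})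
      (by
        intro a b hab x hx i
        have := (Y i).1.res_mem (inf_le_inf_right (c i) hab) (hx i)
        rw [X.res_res] at this ⊢
        exact this)
      (by
        intro a κ d hd x hx i
        have H : IsPartition (fun k => d k ⊓ c i) (a ⊓ c i) := by
          have := hd.inf (c i)
          simpa only [inf_comm] using this
        refine (Y i).1.glue H _ fun k => ?_
        have := hx k i
        rw [X.res_res] at this ⊢
        exact this)
    refine ⟨⟨W, le_top⟩, ?_, ?_⟩
    · intro i
      refine Subtype.ext (CondSubset.ext_sec fun a => Set.ext fun x => ⟨?_, ?_⟩)
      · rintro ⟨ha, hx⟩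
        have H := (show IsPartition (fun _ : PUnit.{u + 1} => a ⊓ c i) a from
          ⟨by simpa using ha, fun i j hij => absurd (Subsingleton.elim i j) hij⟩)
        exact (Y i).1.glue H x fun _ => hx i
      · intro hx
        have ha : a ≤ c i := (((Y i).1.nonempty_iff a).1 ⟨x, hx⟩).trans (Y i).2
        refine ⟨ha, fun j => ?_⟩
        by_cases hij : i = j
        · subst hij
          exact (Y i).1.res_mem _ hx
        · have h0 : a ⊓ c j = ⊥ := le_bot_iff.1 ((inf_le_inf_right _ ha).trans (h.2 i j hij).le)
          have aux : ∀ (b : A) (hb : b ≤ a), b = ⊥ → X.res hb x ∈ (Y j).1.sec b := by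
            rintro _ hb rfl
            exact (Y j).1.mem_bot _
          exact aux _ _ h0
    · rintro ⟨Z, hZ⟩ hz
      have hz' : ∀ i, CondSubset.restrict (c i) Z = (Y i).1 := fun i => congrArg Subtype.val (hz i)
      refine Subtype.ext (CondSubset.ext_sec fun a => Set.ext fun x => ⟨?_, ?_⟩)
      · intro hx i
        rw [← hz' i]
        exact ⟨inf_le_right, Z.res_mem _ hx⟩
      · intro hx
        refine Z.glue (h.inf_of_le (le_top : a ≤ ⊤)) x fun i => ?_
        have := hx i
        rw [← hz' i] at this
        exact this.2

/-- The conditional product of a (nonempty) family of conditional sets. -/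
def prod {I : Type w} (X : I → CondSet.{u, v} A) : CondSet.{u, max w v} A where
  sec a := ∀ i, (X i).sec a
  γ a x i := (X i).γ a (x i)
  nonempty_bot := ⟨fun i => (X i).nonempty_bot.some⟩
  subsingleton_bot := ⟨fun _ _ => funext fun i => (X i).subsingleton_bot.elim _ _⟩
  surjective a y :=
    ⟨fun i => ((X i).surjective a (y i)).choose,
      funext fun i => ((X i).surjective a (y i)).choose_spec⟩
  identity := funext fun x => funext fun i => congrFun (X i).identity (x i)
  consistency a b _ _ h e := funext fun i => (X i).consistency a b _ _ h (congrFun e i)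
  stability c h x := by
    choose y hy huniq using fun i => (X i).stability c h fun j => x j i
    exact ⟨y, fun j => funext fun i => hy i j, fun z hz =>
      funext fun i => huniq i (z i) fun j => congrFun (hz j) i⟩

/-- The conditional set generated by a nonempty set `E`. A formal sum `∑ aᵢ xᵢ` with `(aᵢ) ∈ p(a)`
is identified with the function `z ↦ ⋁ {aᵢ : xᵢ = z}`, so `E_a` is the set of partitions of `a`
indexed by `E`. -/
def generated (A : Type u) [CompleteBooleanAlgebra A] (E : Type w) [Nonempty E] :
    CondSet.{u, max u w} A where
  sec a := {f : E → A // IsPartition f a}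
  γ a f := ⟨fun z => a ⊓ f.1 z, f.2.inf_of_le le_top⟩
  nonempty_bot := ⟨⟨fun _ => ⊥, by simp, fun _ _ _ => by simp⟩⟩
  subsingleton_bot := ⟨fun f g => Subtype.ext <| funext fun z => by
    rw [le_bot_iff.1 (f.2.le z), le_bot_iff.1 (g.2.le z)]⟩
  surjective a := by
    classical
    rintro ⟨f, hf⟩
    let e : E := Classical.arbitrary E
    let g : E → A := fun z => if z = e then aᶜ else ⊥
    have hg : ∀ z, a ⊓ g z = ⊥ := fun z => by
      by_cases h : z = e <;> simp [g, h]
    have hd : ∀ z z', f z ⊓ g z' = ⊥ := fun z z' =>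
      le_bot_iff.1 ((inf_le_inf_right _ (hf.le z)).trans (hg z').le)
    refine ⟨⟨fun z => f z ⊔ g z, ?_, ?_⟩, ?_⟩
    · rw [iSup_sup_eq, hf.1]
      refine top_le_iff.1 ?_
      rw [← sup_compl_eq_top (x := a)]
      exact sup_le_sup_left (le_iSup_of_le e (by simp [g])) _
    · intro z z' hne
      have hgg : g z ⊓ g z' = ⊥ := by
        by_cases h1 : z = e
        · have h2 : z' ≠ e := fun h => hne (h1.trans h.symm)
          simp [g, h2]
        · simp [g, h1]
      rw [inf_sup_right, inf_sup_left, inf_sup_left, hf.2 z z' hne, hd, hgg,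
        inf_comm (g z), hd]
      simp
    · refine Subtype.ext (funext fun z => ?_)
      show a ⊓ (f z ⊔ g z) = f z
      rw [inf_sup_left, hg, sup_bot_eq, inf_eq_right.2 (hf.le z)]
  identity := funext fun f => Subtype.ext (funext fun z => top_inf_eq (f.1 z))
  consistency a b f g h e := by
    refine Subtype.ext (funext fun z => ?_)
    have hz : b ⊓ f.1 z = b ⊓ g.1 z := congrFun (congrArg Subtype.val e) z
    show a ⊓ f.1 z = a ⊓ g.1 z
    rw [← inf_eq_left.2 h, inf_assoc, inf_assoc, hz]
  stability {ι} c h x := by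
    have key : ∀ i z, c i ⊓ (⨆ j, (x j).1 z) = (x i).1 z := by
      intro i z
      rw [inf_iSup_eq]
      refine le_antisymm (iSup_le fun j => ?_) ?_
      · by_cases hij : i = j
        · subst hij; exact inf_le_right
        · exact (inf_le_inf_left _ ((x j).2.le z)).trans ((h.2 i j hij).le.trans bot_le)
      · exact le_iSup_of_le i (le_inf ((x i).2.le z) le_rfl)
    refine ⟨⟨fun z => ⨆ i, (x i).1 z, ?_, ?_⟩, ?_, ?_⟩
    · rw [iSup_comm, ← h.1]
      exact iSup_congr fun i => (x i).2.1
    · intro z z' hne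
      rw [iSup_inf_iSup]
      refine le_bot_iff.1 (iSup_le ?_)
      rintro ⟨i, j⟩
      by_cases hij : i = j
      · subst hij
        exact ((x i).2.2 z z' hne).le
      · exact (inf_le_inf ((x i).2.le z) ((x j).2.le z')).trans (h.2 i j hij).le
    · exact fun i => Subtype.ext (funext fun z => key i z)
    · intro g hg
      refine Subtype.ext (funext fun z => ?_)
      show g.1 z = ⨆ i, (x i).1 z
      have hgz : ∀ i, c i ⊓ g.1 z = (x i).1 z := fun i => congrFun (congrArg Subtype.val (hg i)) z
      rw [← iSup_congr hgz, ← iSup_inf_eq, h.1, top_inf_eq]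

/-- The conditional natural numbers, generated by `{1, 2, 3, …}`. -/
abbrev nat (A : Type u) [CompleteBooleanAlgebra A] : CondSet.{u, u} A := generated A ℕ+

/-- The conditional relation generated by `≤`: `∑ aᵢ kᵢ ≤ ∑ bⱼ nⱼ` if `kᵢ ≤ nⱼ` whenever the
conditions `aᵢ` and `bⱼ` meet. -/
def natLE {a : A} (k n : (nat A).sec a) : Prop :=
  ∀ i j : ℕ+, k.1 i ⊓ n.1 j ≠ ⊥ → i ≤ j

theorem res_nat {a b : A} (h : b ≤ a) (k : (nat A).sec a) (i : ℕ+) :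
    ((nat A).res h k).1 i = b ⊓ k.1 i := by
  obtain ⟨k, rfl⟩ := (nat A).surjective a k
  rw [res_γ]
  show b ⊓ k.1 i = b ⊓ (a ⊓ k.1 i)
  rw [← inf_assoc, inf_eq_left.2 h]

/-- The conditional subset `{1 ≤ k ≤ n}` of the conditional natural numbers
(`1 ≤ k` holds for every `k`). -/
def initialSegment (n : (nat A).sec ⊤) : CondSubset (nat A) :=
  CondSubset.ofSections (fun a => {k | natLE k ((nat A).γ a n)})
    (by
      intro a b h k hk i j hij
      refine hk i j fun h0 => hij ?_
      rw [res_nat]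
      refine le_bot_iff.1 (le_trans ?_ h0.le)
      show b ⊓ k.1 i ⊓ (b ⊓ n.1 j) ≤ k.1 i ⊓ (a ⊓ n.1 j)
      exact inf_le_inf inf_le_right (inf_le_inf_right _ h))
    (by
      intro a ι c h k hk i j hij
      by_contra hn
      refine hij ?_
      have key : ∀ t, c t ⊓ (k.1 i ⊓ n.1 j) = ⊥ := by
        intro t
        by_contra h0
        refine hn (hk t i j fun h1 => h0 ?_)
        rw [res_nat] at h1
        refine le_bot_iff.1 (le_trans ?_ h1.le)
        show c t ⊓ (k.1 i ⊓ n.1 j) ≤ c t ⊓ k.1 i ⊓ (c t ⊓ n.1 j)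
        rw [inf_inf_distrib_left]
      show k.1 i ⊓ (a ⊓ n.1 j) = ⊥
      have h2 : (⨆ t, c t) ⊓ (k.1 i ⊓ n.1 j) = ⊥ := by
        rw [iSup_inf_eq]
        simp only [key, iSup_bot]
      rw [inf_left_comm]
      exact (congrArg (fun b => b ⊓ (k.1 i ⊓ n.1 j)) h.1).symm.trans h2)

theorem initialSegment_dom (n : (nat A).sec ⊤) : (initialSegment n).dom = ⊤ := by
  refine top_le_iff.1 (((initialSegment n).nonempty_iff ⊤).1 ⟨n, ?_⟩)
  intro i j hij
  by_contra hn
  refine hij ?_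
  show n.1 i ⊓ (⊤ ⊓ n.1 j) = ⊥
  rw [top_inf_eq]
  exact n.2.2 i j fun e => hn e.le

/-- `{1 ≤ k ≤ n}` as a conditional set on `A`. -/
def upTo (n : (nat A).sec ⊤) : CondSet.{u, u} A :=
  (initialSegment n).toCondSet (initialSegment_dom n)

end CondSet

/-- A conditional function `f : X → Y`: functions `f_a : X_a → Y_a` with
`f_⊤(∑ aᵢ xᵢ) = ∑ aᵢ f_{aᵢ}(xᵢ)`, that is, `a f_⊤(x) = f_a(a x)` for all `a` and `x`. -/
structure CondFun {A : Type u} [CompleteBooleanAlgebra A] (X : CondSet.{u, v} A)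
    (Y : CondSet.{u, w} A) where
  toFun : ∀ a, X.sec a → Y.sec a
  map_γ : ∀ a x, toFun a (X.γ a x) = Y.γ a (toFun ⊤ x)

namespace CondFun

variable {A : Type u} [CompleteBooleanAlgebra A]

theorem map_res {X : CondSet.{u, v} A} {Y : CondSet.{u, w} A} (f : CondFun X Y) {a b : A}
    (h : b ≤ a) (x : X.sec a) : f.toFun b (X.res h x) = Y.res h (f.toFun a x) := by
  obtain ⟨x, rfl⟩ := X.surjective a x
  rw [X.res_γ, f.map_γ, f.map_γ, Y.res_γ]

/-- The conditional preimage of `V` under `f`; it lives on the largest `c` for which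
`f_c⁻¹(V_c)` is nonempty. -/
def preimage {X : CondSet.{u, v} A} {Y : CondSet.{u, w} A} (f : CondFun X Y) (V : CondSubset Y) :
    CondSubset X :=
  CondSubset.ofSections (fun a => {x | f.toFun a x ∈ V.sec a})
    (fun h x hx => by
      show f.toFun _ (X.res h x) ∈ V.sec _
      rw [f.map_res]
      exact V.res_mem h hx)
    (fun c h x hx => V.glue h _ fun i => by
      rw [← f.map_res]
      exact hx i)

/-- The conditional projection onto the `i`-th factor. -/
def proj {I : Type w} (X : I → CondSet.{u, v} A) (i : I) : CondFun (CondSet.prod X) (X i) where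
  toFun _ x := x i
  map_γ _ _ := rfl

end CondFun

/-- `Y`, as a conditional element of `P(X)`, belongs to the conditional system `𝒮 ⊑ P(X)`. -/
def CondSubset.MemSystem {A : Type u} [CompleteBooleanAlgebra A] {X : CondSet.{u, v} A}
    (Y : CondSubset X) (S : CondSubset X.powerset) : Prop :=
  (⟨Y, le_top⟩ : X.powerset.sec ⊤) ∈ S.sec ⊤

/-- A conditional topology on `X`: a conditional system `opens ∈ P(P(X))` containing `𝟎` and `X`,
closed under finite conditional intersections and arbitrary conditional unions. -/
structure CondTopology {A : Type u} [CompleteBooleanAlgebra A] (X : CondSet.{u, v} A) where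
  opens : CondSubset X.powerset
  empty_mem : (CondSubset.empty X).MemSystem opens
  univ_mem : (CondSubset.univ X).MemSystem opens
  inter_mem : ∀ Y Z : CondSubset X, Y.MemSystem opens → Z.MemSystem opens →
    (CondSubset.condInter (fun t : Bool => cond t Y Z)).MemSystem opens
  union_mem : ∀ S : Set (CondSubset X), (∀ Y ∈ S, Y.MemSystem opens) →
    (CondSubset.condUnion (fun Y : S => Y.1)).MemSystem opens

namespace CondTopology

variable {A : Type u} [CompleteBooleanAlgebra A]

/-- The conditional topology generated by `𝒢 ⊑ P(X)`: the conditional intersection of all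
conditional topologies `𝒯` with `𝒢 ⊑ 𝒯`. -/
def generate {X : CondSet.{u, v} A} (G : CondSubset X.powerset) : CondTopology X where
  opens := CondSubset.condInter (fun T : {T : CondTopology X // G ≤ T.opens} => T.1.opens)
  empty_mem T := T.1.empty_mem
  univ_mem T := T.1.univ_mem
  inter_mem Y Z hY hZ T := T.1.inter_mem Y Z (hY T) (hZ T)
  union_mem S hS T := T.1.union_mem S fun Y h => hS Y h T

/-- The conditional initial topology for a family of conditional functions: it is generated by the
stable hull of the set of all conditional preimages of conditionally open sets. -/
def initial {X : CondSet.{u, v} A} {I : Type w} {Y : I → CondSet.{u, w'} A}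
    (T : ∀ i, CondTopology (Y i)) (f : ∀ i, CondFun X (Y i)) : CondTopology X :=
  generate (CondSubset.stableHull
    {U : X.powerset.sec ⊤ | ∃ i, ∃ O : CondSubset (Y i), O.MemSystem (T i).opens ∧
      U.1 = (f i).preimage O})

/-- The conditional product topology. -/
def product {I : Type w} {X : I → CondSet.{u, v} A} (T : ∀ i, CondTopology (X i)) :
    CondTopology (CondSet.prod X) :=
  initial T (CondFun.proj X)

/-- Conditional compactness: for every conditional open covering `(O^j)_{j ∈ J}` (a conditional
family of conditionally open sets with `X ⊑ ⊔ O^j`) there are a conditional natural number `n` and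
a conditional family `(j_k)_{1 ≤ k ≤ n}` in `J` such that `X ⊑ ⊔_{1 ≤ k ≤ n} O^{j_k}`.
The universe of `J` is large enough for `J` to be any conditional system of subsets of `X`. -/
def Compact {X : CondSet.{u, v} A} (T : CondTopology X) : Prop :=
  ∀ (J : CondSet.{u, max u v} A) (O : CondFun J X.powerset),
    (∀ j : J.sec ⊤, (O.toFun ⊤ j).1.MemSystem T.opens) →
    CondSubset.univ X ≤ CondSubset.condUnion (fun j : J.sec ⊤ => (O.toFun ⊤ j).1) →
    ∃ (n : (CondSet.nat A).sec ⊤) (φ : CondFun (CondSet.upTo n) J),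
      CondSubset.univ X ≤ CondSubset.condUnion
        (fun k : (CondSet.upTo n).sec ⊤ => (O.toFun ⊤ (φ.toFun ⊤ k)).1)

end CondTopology

/-!
A conditional subset `Y` of `X` is determined by the function sending a global point `x` to the
largest condition `truth Y x` on which `x` belongs to `Y`. Under `truth`, conditional unions,
intersections, restrictions and preimages become pointwise operations in the Boolean algebra, so
that conditional set theory turns into the calculus of `A`-valued functions.

In these terms conditional compactness has a form without conditional families
(`CondTopology.Compact.exists_finset`, `CondTopology.compact_of_exists_finset`): whenever a plain
set `S` of open sets covers `X`, there is below every nonzero condition a nonzero condition on which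
finitely many members of `S` cover `X`. Passing from conditional families to this form uses that a
conditional natural number is locally constant; passing back glues the finite subcovers along a
partition.

Compactness of a factor follows since preimages of a cover under a projection cover the product.
For the converse, let an open cover `S` of the product have no finite subcover on any nonzero
condition below `b`. By the Teichmüller–Tukey lemma `S` lies in a maximal family `M` with this
property. For each `i`, the open sets of `X i` whose cylinders lie in `M` have no finite subcover
below `b` either, so by compactness they do not cover `X i` on any nonzero condition below `b`, and
the maximum principle (`CondSubset.exists_inf_truth_eq_bot`) gives a single point `x i` outside all
of them on all of `b` (`CondTopology.exists_coordinate`). Some `O ∈ S` contains `x` on a nonzero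
condition, and on a smaller one `O` contains a finite intersection of open cylinders around `x`
(`CondTopology.locallyGenerated_of_mem_generate`). Since `M` is prime
(`CondSubset.exists_restrict_mem`), a restriction of one of these cylinders belongs to `M`, which
contradicts the choice of `x`.
-/

/-! ### Truth values -/

theorem IsPartition.uliftIndex {A : Type u} [CompleteBooleanAlgebra A] {ι : Type w} {c : ι → A}
    {a : A} (h : IsPartition c a) : IsPartition (fun i : ULift.{w'} ι => c i.down) a :=
  ⟨by rw [← h.1]; exact Equiv.ulift.iSup_congr fun _ => rfl,
    fun i j hij => h.2 _ _ fun e => hij (ULift.down_injective e)⟩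

namespace CondSubset

variable {A : Type u} [CompleteBooleanAlgebra A] {X : CondSet.{u, v} A}

/-- The Boolean truth value of `x ∈ Y`: the largest condition `a` with `a x ∈ Y_a`
(see `le_truth_iff`). -/
def truth (Y : CondSubset X) (x : X.sec ⊤) : A :=
  sSup {a | X.γ a x ∈ Y.sec a}

theorem le_truth_iff {Y : CondSubset X} {x : X.sec ⊤} {a : A} :
    a ≤ Y.truth x ↔ X.γ a x ∈ Y.sec a := by
  refine ⟨fun h => ?_, fun h => le_sSup h⟩
  obtain ⟨d, hd, hle⟩ := IsPartition.exists_le (fun b : {b : A // X.γ b x ∈ Y.sec b} => b.1)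
  have hsup : (⨆ b : {b : A // X.γ b x ∈ Y.sec b}, b.1) = Y.truth x := (sSup_eq_iSup' _).symm
  rw [hsup] at hd
  refine Y.glue (hd.inf_of_le h) _ fun b => ?_
  rw [X.res_γ, ← X.res_γ (inf_le_right.trans (hle b) : a ⊓ d b ≤ b.1)]
  exact Y.res_mem _ b.2

theorem le_iff_truth_le {Y Z : CondSubset X} : Y ≤ Z ↔ ∀ x, Y.truth x ≤ Z.truth x := by
  refine ⟨fun h x => le_truth_iff.2 (h _ (le_truth_iff.1 le_rfl)), fun h a x hx => ?_⟩
  obtain ⟨x, rfl⟩ := X.surjective a x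
  exact le_truth_iff.1 ((le_truth_iff.2 hx).trans (h x))

theorem truth_le_dom (Y : CondSubset X) (x : X.sec ⊤) : Y.truth x ≤ Y.dom :=
  (Y.nonempty_iff _).1 ⟨_, le_truth_iff.1 le_rfl⟩

/-- Truth values depend only on the part of the point that is seen by the condition. -/
theorem inf_truth_congr (Y : CondSubset X) {a : A} {x y : X.sec ⊤} (h : X.γ a x = X.γ a y) :
    a ⊓ Y.truth x = a ⊓ Y.truth y := by
  have key : ∀ {x y : X.sec ⊤}, X.γ a x = X.γ a y → a ⊓ Y.truth x ≤ Y.truth y := by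
    intro x y h
    rw [le_truth_iff, ← X.consistency _ a _ _ inf_le_left h, ← le_truth_iff]
    exact inf_le_right
  exact le_antisymm (le_inf inf_le_left (key h)) (le_inf inf_le_left (key h.symm))

@[simp]
theorem truth_univ (x : X.sec ⊤) : (univ X).truth x = ⊤ :=
  top_le_iff.1 (le_truth_iff.2 (Set.mem_univ _))

@[simp]
theorem truth_empty (x : X.sec ⊤) : (empty X).truth x = ⊥ := by
  have h : X.γ ((empty X).truth x) x ∈ (empty X).sec _ := le_truth_iff.1 le_rfl
  exact h

@[simp]
theorem truth_restrict (a : A) (Y : CondSubset X) (x : X.sec ⊤) :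
    (restrict a Y).truth x = a ⊓ Y.truth x := by
  refine eq_of_forall_le_iff fun c => ?_
  rw [le_inf_iff, le_truth_iff, le_truth_iff]
  exact Iff.rfl

@[simp]
theorem truth_condInter {κ : Type w} (Y : κ → CondSubset X) (x : X.sec ⊤) :
    (condInter Y).truth x = ⨅ i, (Y i).truth x := by
  refine eq_of_forall_le_iff fun c => ?_
  simp only [le_iInf_iff, le_truth_iff]
  exact Iff.rfl

@[simp]
theorem truth_condUnion {κ : Type w} (Y : κ → CondSubset X) (x : X.sec ⊤) :
    (condUnion Y).truth x = ⨆ i, (Y i).truth x := by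
  refine le_antisymm ?_ (iSup_le fun i =>
    le_iff_truth_le.1 ((isLUB_condUnion Y).1 ⟨i, rfl⟩) x)
  obtain ⟨b, hb, hx⟩ := (le_truth_iff (Y := condUnion Y) (x := x)).1 le_rfl
  rw [← hb.1]
  refine iSup_mono fun i => le_truth_iff.2 ?_
  have := hx i
  rwa [X.res_γ] at this

@[simp]
theorem truth_preimage {Z : CondSet.{u, w} A} (f : CondFun X Z) (V : CondSubset Z)
    (x : X.sec ⊤) : (f.preimage V).truth x = V.truth (f.toFun ⊤ x) := by
  refine eq_of_forall_le_iff fun c => ?_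
  rw [le_truth_iff, le_truth_iff, ← f.map_γ]
  exact Iff.rfl

theorem ext_truth {Y Z : CondSubset X} (h : ∀ x, Y.truth x = Z.truth x) : Y = Z :=
  le_antisymm (le_iff_truth_le.2 fun x => (h x).le) (le_iff_truth_le.2 fun x => (h x).ge)

theorem univ_le_condUnion_iff {κ : Type w} {Y : κ → CondSubset X} :
    univ X ≤ condUnion Y ↔ ∀ x, ⨆ i, (Y i).truth x = ⊤ := by
  simp [le_iff_truth_le]

theorem res_powerset {a b : A} (h : b ≤ a) (Y : X.powerset.sec a) :
    (X.powerset.res h Y).1 = restrict b Y.1 := by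
  obtain ⟨Y, rfl⟩ := X.powerset.surjective a Y
  rw [CondSet.res_γ]
  exact (restrict_restrict h Y.1).symm

theorem res_powerset_congr {a b : A} {h : b ≤ a} {Y Z : X.powerset.sec a}
    (e : restrict b Y.1 = restrict b Z.1) : X.powerset.res h Y = X.powerset.res h Z :=
  Subtype.ext (by rw [res_powerset, res_powerset, e])

theorem inf_truth_eq_of_γ_eq {a : A} {Y Z : X.powerset.sec ⊤}
    (h : X.powerset.γ a Y = X.powerset.γ a Z) (x : X.sec ⊤) :
    a ⊓ Y.1.truth x = a ⊓ Z.1.truth x := by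
  rw [← truth_restrict, ← truth_restrict]
  exact congrArg (fun W : X.powerset.sec a => W.1.truth x) h

theorem stableHull_le {G : Set (X.sec ⊤)} {Y : CondSubset X} (h : G ⊆ Y.sec ⊤) :
    stableHull G ≤ Y := by
  rintro a x ⟨ι, c, hc, hx⟩
  refine Y.glue hc x fun i => ?_
  obtain ⟨y, hy, hxy⟩ := hx i
  rw [hxy, ← X.res_top le_top]
  exact Y.res_mem le_top (h hy)

theorem subset_stableHull (G : Set (X.sec ⊤)) : G ⊆ (stableHull G).sec ⊤ := by
  intro x hx
  refine ⟨PUnit, fun _ => ⊤, ⟨by simp, fun i j hij => absurd (Subsingleton.elim i j) hij⟩,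
    fun _ => ⟨x, hx, X.res_top le_top x⟩⟩

/-- The maximum principle: if `Y` is not everything on any condition below `b`, then a single
point lies outside `Y` on all of `b`. -/
theorem exists_inf_truth_eq_bot (Y : CondSubset X) {b : A}
    (h : ∀ c ≤ b, (∀ x, c ≤ Y.truth x) → c = ⊥) : ∃ x, b ⊓ Y.truth x = ⊥ := by
  let D : Set A := {c | ∃ x, c ⊓ Y.truth x = ⊥}
  obtain ⟨d, hd, hle⟩ := IsPartition.exists_le (fun c : D => c.1)
  choose z hz using fun c : D => c.2
  obtain ⟨y, hy⟩ := X.exists_amalg' hd fun c => X.γ (d c) (z c)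
  obtain ⟨x, rfl⟩ := X.surjective _ y
  have hx : ∀ c, d c ⊓ Y.truth x = ⊥ := fun c => by
    rw [Y.inf_truth_congr (by rw [← hy c, X.res_γ] : X.γ (d c) x = X.γ (d c) (z c))]
    exact le_bot_iff.1 ((inf_le_inf_right _ (hle c)).trans (hz c).le)
  refine ⟨x, ?_⟩
  have hb : b ≤ ⨆ c : D, c.1 := by
    rw [← sdiff_eq_bot_iff]
    refine h _ sdiff_le fun t => ?_
    have ht : b \ Y.truth t ≤ ⨆ c : D, c.1 :=
      le_iSup (fun c : D => c.1) ⟨_, t, by rw [inf_comm, inf_sdiff_self_right]⟩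
    rw [sdiff_le_iff, sup_comm, ← sdiff_le_iff]
    exact ht
  refine le_bot_iff.1 ((inf_le_inf_right _ hb).trans ?_)
  rw [← hd.1, iSup_inf_eq]
  exact iSup_le fun c => (hx c).le

end CondSubset

/-! ### Generated topologies -/

namespace CondTopology

open CondSubset

variable {A : Type u} [CompleteBooleanAlgebra A] {X : CondSet.{u, v} A}

theorem restrict_mem (T : CondTopology X) {Y : CondSubset X} (hY : Y.MemSystem T.opens) (a : A) :
    (restrict a Y).MemSystem T.opens := by
  refine T.opens.glue (IsPartition.self_compl a) _ ?_
  rintro ⟨_ | _⟩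
  · refine Eq.subst (motive := (· ∈ T.opens.sec aᶜ)) (res_powerset_congr ?_)
      (T.opens.res_mem le_top T.empty_mem)
    exact ext_truth fun x => by simp [← inf_assoc]
  · exact Eq.subst (motive := (· ∈ T.opens.sec a))
      (res_powerset_congr (restrict_restrict le_rfl Y).symm) (T.opens.res_mem le_top hY)

theorem le_generate (G : CondSubset X.powerset) : G ≤ (generate G).opens :=
  (isGLB_condInter _).2 (by rintro _ ⟨T, rfl⟩; exact T.2)

theorem generate_le {G : CondSubset X.powerset} {T : CondTopology X} (h : G ≤ T.opens) :
    (generate G).opens ≤ T.opens :=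
  (isGLB_condInter fun T : {T : CondTopology X // G ≤ T.opens} => T.1.opens).1 ⟨⟨T, h⟩, rfl⟩

/-- Every point of `O` has, locally in the conditions, a neighbourhood inside `O` that is a finite
intersection of members of `G`. -/
def LocallyGenerated (G : Set (X.powerset.sec ⊤)) (O : CondSubset X) : Prop :=
  ∀ x, ∀ b ≤ O.truth x, b ≠ ⊥ → ∃ c ≤ b, c ≠ ⊥ ∧ ∃ F : Finset (CondSubset X),
    (∀ Y ∈ F, (⟨Y, le_top⟩ : X.powerset.sec ⊤) ∈ G) ∧ c ≤ F.inf (fun Y => Y.truth x) ∧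
      ∀ y, c ⊓ F.inf (fun Y => Y.truth y) ≤ O.truth y

theorem LocallyGenerated.restrict {G : Set (X.powerset.sec ⊤)} {O : CondSubset X}
    (h : LocallyGenerated G O) (a : A) : LocallyGenerated G (restrict a O) := by
  intro x b hb hb0
  rw [truth_restrict] at hb
  obtain ⟨c, hc, hc0, F, hF, h1, h2⟩ := h x b (hb.trans inf_le_right) hb0
  refine ⟨c, hc, hc0, F, hF, h1, fun y => ?_⟩
  rw [truth_restrict]
  exact le_inf (inf_le_left.trans (hc.trans (hb.trans inf_le_left))) (h2 y)

theorem LocallyGenerated.of_restrict {G : Set (X.powerset.sec ⊤)} {O : CondSubset X} {a : A}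
    {ι : Type w} {c : ι → A} (hc : IsPartition c a) (ha : O.dom ≤ a)
    (h : ∀ i, LocallyGenerated G (CondSubset.restrict (c i) O)) : LocallyGenerated G O := by
  intro x b hb hb0
  have : ∃ i, b ⊓ c i ≠ ⊥ := by
    by_contra! hn
    refine hb0 ?_
    rw [← (hc.inf_of_le (hb.trans ((O.truth_le_dom x).trans ha))).1]
    simp [hn]
  obtain ⟨i, hi⟩ := this
  obtain ⟨d, hd, hd0, F, hF, h1, h2⟩ := h i x (b ⊓ c i)
    (by rw [truth_restrict]; exact le_inf inf_le_right (inf_le_left.trans hb)) hi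
  refine ⟨d, hd.trans inf_le_left, hd0, F, hF, h1, fun y => (h2 y).trans ?_⟩
  rw [truth_restrict]
  exact inf_le_right

/-- The conditional topology with subbase `G`, described through neighbourhoods. -/
def ofSubbase (G : Set (X.powerset.sec ⊤)) : CondTopology X where
  opens := CondSubset.ofSections (X := X.powerset) (fun _ => {Y | LocallyGenerated G Y.1})
    (fun h Y hY => by
      show LocallyGenerated G _
      rw [res_powerset]
      exact LocallyGenerated.restrict hY _)
    (fun c h Y hY => LocallyGenerated.of_restrict h Y.2 fun i => by
      have : LocallyGenerated G _ := hY i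
      rwa [res_powerset] at this)
  empty_mem := by
    intro x b hb hb0
    rw [truth_empty] at hb
    exact absurd (le_bot_iff.1 hb) hb0
  univ_mem := fun x b _ hb0 => ⟨b, le_rfl, hb0, ∅, by simp, by simp, by simp⟩
  inter_mem Y Z hY hZ := by
    classical
    intro x b hb hb0
    have hYZ : ∀ y, (condInter fun t : Bool => cond t Y Z).truth y = Y.truth y ⊓ Z.truth y := by
      simp [iInf_bool_eq]
    rw [hYZ] at hb
    obtain ⟨c, hc, hc0, F, hF, h1, h2⟩ := hY x b (hb.trans inf_le_left) hb0
    obtain ⟨d, hd, hd0, F', hF', h1', h2'⟩ := hZ x c (hc.trans (hb.trans inf_le_right)) hc0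
    refine ⟨d, hd.trans hc, hd0, F ∪ F', ?_, ?_, fun y => ?_⟩
    · intro W hW
      rcases Finset.mem_union.1 hW with h | h
      exacts [hF W h, hF' W h]
    · rw [Finset.inf_union]
      exact le_inf (hd.trans h1) h1'
    · rw [hYZ, Finset.inf_union]
      exact le_inf ((inf_le_inf hd inf_le_left).trans (h2 y))
        ((inf_le_inf_left _ inf_le_right).trans (h2' y))
  union_mem S hS := by
    intro x b hb hb0
    rw [truth_condUnion] at hb
    have : ∃ Y : S, b ⊓ Y.1.truth x ≠ ⊥ := by
      by_contra! hn
      refine hb0 ?_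
      rw [← inf_eq_left.2 hb, inf_iSup_eq]
      simp [hn]
    obtain ⟨Y, hY⟩ := this
    obtain ⟨c, hc, hc0, F, hF, h1, h2⟩ := hS Y.1 Y.2 x _ inf_le_right hY
    refine ⟨c, hc.trans inf_le_left, hc0, F, hF, h1, fun y => (h2 y).trans ?_⟩
    rw [truth_condUnion]
    exact le_iSup (fun Y : S => Y.1.truth y) Y

theorem locallyGenerated_of_mem_generate {G : Set (X.powerset.sec ⊤)} {O : CondSubset X}
    (hO : O.MemSystem (generate (stableHull G)).opens) : LocallyGenerated G O := by
  have h : stableHull G ≤ (ofSubbase G).opens := by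
    refine stableHull_le fun Y hY x b hb hb0 => ⟨b, le_rfl, hb0, {Y.1}, ?_, ?_, ?_⟩
    · exact fun Z hZ => Finset.mem_singleton.1 hZ ▸ hY
    · simpa using hb
    · simp
  exact generate_le h ⊤ hO

end CondTopology

/-! ### Compactness through finite subcovers on a dense set of conditions -/

namespace IsPartition

variable {A : Type u} [CompleteBooleanAlgebra A]

theorem map {ι : Type v} {κ : Type w} {c : ι → A} {a : A} (h : IsPartition c a) (f : ι → κ) :
    IsPartition (fun z => ⨆ i, ⨆ _ : f i = z, c i) a := by
  refine ⟨?_, fun z z' hne => ?_⟩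
  · rw [← h.1, iSup_comm]
    exact iSup_congr fun i => by simp
  · simp only [iSup_inf_eq, inf_iSup_eq, iSup_eq_bot]
    rintro i rfl j rfl
    exact h.2 j i fun e => hne (by rw [e])

theorem le_map {ι : Type v} {κ : Type w} (c : ι → A) (f : ι → κ) {i : ι} {z : κ}
    (hi : f i = z) : c i ≤ ⨆ i, ⨆ _ : f i = z, c i :=
  le_iSup₂_of_le i hi le_rfl

/-- A nonzero condition below the supremum of a partition meets one of its members. -/
theorem exists_inf_ne_bot {ι : Type w} {c : ι → A} {a b : A} (h : IsPartition c a) (hb : b ≤ a)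
    (hb0 : b ≠ ⊥) : ∃ i, b ⊓ c i ≠ ⊥ := by
  by_contra! hn
  refine hb0 ?_
  rw [← (h.inf_of_le hb).1]
  simp [hn]

end IsPartition

namespace CondSet

variable {A : Type u} [CompleteBooleanAlgebra A]

/-- On a condition where two conditional naturals both equal `l`, they agree. -/
theorem γ_nat_eq {k k' : (nat A).sec ⊤} {l : ℕ+} {a : A} (h : a ≤ k.1 l) (h' : a ≤ k'.1 l) :
    (nat A).γ a k = (nat A).γ a k' := by
  have key : ∀ {k : (nat A).sec ⊤}, a ≤ k.1 l → ∀ z, a ⊓ k.1 z = if z = l then a else ⊥ := by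
    intro k h z
    split_ifs with hz
    · exact inf_eq_left.2 (hz ▸ h)
    · exact le_bot_iff.1 ((inf_le_inf_right _ h).trans (k.2.2 l z (Ne.symm hz)).le)
  refine Subtype.ext (funext fun z => ?_)
  show a ⊓ k.1 z = a ⊓ k'.1 z
  rw [key h, key h']

/-- The element `min l n` of `{1 ≤ k ≤ n}`: it equals `l` wherever `n` is at least `l`. -/
theorem exists_upTo_min (n : (nat A).sec ⊤) (l : ℕ+) :
    ∃ k : (upTo n).sec ⊤, ∀ m, l ≤ m → n.1 m ≤ k.1.1 l := by
  refine ⟨⟨⟨_, n.2.map (fun m => min l m)⟩, ?_⟩, fun m hm =>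
    IsPartition.le_map n.1 _ (min_eq_left hm)⟩
  intro i j hij
  by_contra hn
  refine hij ?_
  show (⨆ m, ⨆ _ : min l m = i, n.1 m) ⊓ (⊤ ⊓ n.1 j) = ⊥
  rw [top_inf_eq]
  simp only [iSup_inf_eq, iSup_eq_bot]
  rintro m rfl
  exact n.2.2 m j fun e => hn (e ▸ min_le_right l m)

/-- A sequence in `J` extends to a conditional function on the conditional natural numbers. -/
theorem exists_natFun {J : CondSet.{u, v} A} (s : ℕ+ → J.sec ⊤) :
    ∃ ψ : CondFun (nat A) J, ∀ (k : (nat A).sec ⊤) (l : ℕ+),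
      J.γ (k.1 l) (ψ.toFun ⊤ k) = J.γ (k.1 l) (s l) := by
  have hex : ∀ a (k : (nat A).sec a), ∃ y : J.sec a, ∀ l,
      J.res (k.2.le l) y = J.γ (k.1 l) (s l) := fun a k => by
    obtain ⟨y, hy⟩ := J.exists_amalg' (IsPartition.uliftIndex.{u, 0, u} k.2)
      fun l => J.γ (k.1 l.down) (s l.down)
    exact ⟨y, fun l => hy ⟨l⟩⟩
  choose f hf using hex
  refine ⟨⟨f, fun a k => ?_⟩, fun k l => ?_⟩
  · refine J.eq_of_res' (IsPartition.uliftIndex.{u, 0, u} ((nat A).γ a k).2) fun l => ?_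
    refine (hf a _ l.down).trans ?_
    have h1 : J.res (inf_le_right : a ⊓ k.1 l.down ≤ k.1 l.down)
        (J.res (k.2.le l.down) (f ⊤ k)) = J.γ _ (s l.down) := by rw [hf, J.res_γ]
    rw [J.res_top, J.res_γ] at h1
    rw [J.res_γ]
    exact h1.symm
  · rw [← hf ⊤ k l, J.res_top]

end CondSet

namespace CondTopology

open CondSubset CondSet

variable {A : Type u} [CompleteBooleanAlgebra A] {X : CondSet.{u, v} A}

/-- Finitely many members of a stable hull are, on some nonzero condition, covered by finitely
many generators. -/
theorem exists_generators_of_mem_stableHull {κ : Type w} {G : Set (X.powerset.sec ⊤)}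
    (Z : κ → X.powerset.sec ⊤) (hZ : ∀ k, Z k ∈ (stableHull G).sec ⊤) (s : Finset κ) {b : A}
    (hb : b ≠ ⊥) : ∃ c ≤ b, c ≠ ⊥ ∧ ∃ F : Finset (CondSubset X),
      (∀ Y ∈ F, (⟨Y, le_top⟩ : X.powerset.sec ⊤) ∈ G) ∧
        ∀ k ∈ s, ∀ x, c ⊓ (Z k).1.truth x ≤ F.sup fun Y => Y.truth x := by
  classical
  induction s using Finset.induction_on with
  | empty => exact ⟨b, le_rfl, hb, ∅, by simp, by simp⟩
  | insert k s _ ih =>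
    obtain ⟨c, hc, hc0, F, hF, hcov⟩ := ih
    obtain ⟨ι, d, hd, hm⟩ := hZ k
    obtain ⟨i, hi⟩ := hd.exists_inf_ne_bot le_top hc0
    obtain ⟨y, hy, hZy⟩ := hm i
    rw [CondSet.res_top] at hZy
    refine ⟨c ⊓ d i, inf_le_left.trans hc, hi, insert y.1 F, ?_, ?_⟩
    · intro Y hY
      rcases Finset.mem_insert.1 hY with rfl | h
      exacts [hy, hF Y h]
    · intro j hj x
      rw [Finset.sup_insert]
      rcases Finset.mem_insert.1 hj with rfl | h
      · refine le_sup_of_le_left ?_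
        rw [inf_assoc, inf_truth_eq_of_γ_eq hZy]
        exact inf_le_right.trans inf_le_right
      · exact le_sup_of_le_right ((inf_le_inf_right _ inf_le_left).trans (hcov j h x))

/-- In a conditionally compact space, every cover by a plain set of conditionally open sets has
finite subcovers on a dense set of conditions. The converse is `compact_of_exists_finset`. -/
theorem Compact.exists_finset {T : CondTopology X} (hT : T.Compact) {S : Set (CondSubset X)}
    (hS : ∀ Y ∈ S, Y.MemSystem T.opens) (hcov : ∀ x, ⨆ Y : S, Y.1.truth x = ⊤) {b : A}
    (hb : b ≠ ⊥) : ∃ c ≤ b, c ≠ ⊥ ∧ ∃ F : Finset (CondSubset X), (F : Set (CondSubset X)) ⊆ S ∧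
      ∀ x, c ≤ F.sup fun Y => Y.truth x := by
  obtain ⟨x₀⟩ := X.nonempty_sec ⊤
  have hSne : S.Nonempty := by
    by_contra hn
    have : IsEmpty S := Set.isEmpty_coe_sort.2 (Set.not_nonempty_iff_eq_empty.1 hn)
    exact hb (le_bot_iff.1 (le_top.trans (by rw [← hcov x₀]; simp)))
  let G : Set (X.powerset.sec ⊤) := {U | U.1 ∈ S}
  have hGmem : ∀ Y ∈ S, (⟨Y, le_top⟩ : X.powerset.sec ⊤) ∈ (stableHull G).sec ⊤ :=
    fun Y hY => subset_stableHull G hY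
  have hdom : (stableHull G).dom = ⊤ := by
    obtain ⟨Y, hY⟩ := hSne
    exact top_le_iff.1 (((stableHull G).nonempty_iff ⊤).1 ⟨_, hGmem Y hY⟩)
  let O : CondFun ((stableHull G).toCondSet hdom) X.powerset :=
    ⟨fun _ U => U.1, fun _ _ => rfl⟩
  obtain ⟨n, φ, hφ⟩ := hT _ O
    (fun j => stableHull_le (Y := T.opens) (fun U hU => hS U.1 hU) ⊤ j.2)
    (univ_le_condUnion_iff.2 fun x => by
      refine top_le_iff.1 ((hcov x).ge.trans (iSup_le fun Y => ?_))
      exact le_iSup (fun j : ((stableHull G).toCondSet hdom).sec ⊤ => (O.toFun ⊤ j).1.truth x)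
        ⟨_, hGmem Y.1 Y.2⟩)
  rw [univ_le_condUnion_iff] at hφ
  obtain ⟨m, hm⟩ := n.2.exists_inf_ne_bot le_top hb
  choose q hl using exists_upTo_min n
  let Z : ℕ+ → X.powerset.sec ⊤ := fun l => O.toFun ⊤ (φ.toFun ⊤ (q l))
  obtain ⟨c, hc, hc0, F, hF, hle⟩ := exists_generators_of_mem_stableHull (G := G) Z
    (fun l => (φ.toFun ⊤ (q l)).2) (Finset.Icc 1 m) hm
  refine ⟨c, hc.trans inf_le_left, hc0, F, fun Y hY => hF Y hY, fun x => ?_⟩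
  rw [← inf_top_eq c, ← hφ x, inf_iSup_eq]
  refine iSup_le fun k => ?_
  -- On the part of `c` where `k = l`, the set indexed by `k` is the one indexed by `min l n`.
  have hk : c = ⨆ l, c ⊓ k.1.1 l := by
    rw [← inf_iSup_eq, k.1.2.1, inf_top_eq]
  rw [hk, iSup_inf_eq]
  refine iSup_le fun l => ?_
  by_cases h0 : c ⊓ k.1.1 l = ⊥
  · simp [h0]
  have hcm : c ⊓ k.1.1 l ≤ n.1 m := inf_le_left.trans (hc.trans inf_le_right)
  have hlm : l ≤ m := by
    refine k.2 l m fun h1 => h0 (le_bot_iff.1 (le_trans ?_ h1.le))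
    exact le_inf inf_le_right (le_inf le_top hcm)
  have e1 : (upTo n).γ (c ⊓ k.1.1 l) k = (upTo n).γ (c ⊓ k.1.1 l) (q l) :=
    Subtype.ext (γ_nat_eq inf_le_right (hcm.trans (hl l m hlm)))
  have e2 : X.powerset.γ (c ⊓ k.1.1 l) (O.toFun ⊤ (φ.toFun ⊤ k)) =
      X.powerset.γ (c ⊓ k.1.1 l) (Z l) := by
    rw [← O.map_γ, ← φ.map_γ, e1, φ.map_γ, O.map_γ]
  rw [inf_truth_eq_of_γ_eq e2]
  exact (inf_le_inf_right _ inf_le_left).trans (hle l (Finset.mem_Icc.2 ⟨one_le, hlm⟩) x)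

theorem exists_enumeration_of_subset_range {α : Type v} {β : Type w} [Nonempty α] {f : α → β}
    (F : Finset β) (hF : (F : Set β) ⊆ Set.range f) :
    ∃ (m : ℕ+) (s : ℕ+ → α), ∀ y ∈ F, ∃ l ≤ m, f (s l) = y := by
  classical
  induction F using Finset.induction_on with
  | empty => exact ⟨1, fun _ => Classical.arbitrary α, by simp⟩
  | insert y F _ ih =>
    obtain ⟨m, s, hs⟩ := ih fun z hz => hF (Finset.mem_insert_of_mem hz)
    obtain ⟨a, ha⟩ := hF (Finset.mem_insert_self y F)
    refine ⟨m + 1, Function.update s (m + 1) a, fun z hz => ?_⟩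
    rcases Finset.mem_insert.1 hz with rfl | h
    · exact ⟨m + 1, le_rfl, by simpa using ha⟩
    · obtain ⟨l, hl, rfl⟩ := hs z h
      have hlm : l < m + 1 := PNat.lt_add_one_iff.2 hl
      exact ⟨l, hlm.le, by rw [Function.update_of_ne hlm.ne]⟩

theorem compact_of_exists_finset {T : CondTopology X}
    (h : ∀ S : Set (CondSubset X), (∀ Y ∈ S, Y.MemSystem T.opens) →
      (∀ x, ⨆ Y : S, Y.1.truth x = ⊤) → ∀ b ≠ ⊥, ∃ c ≤ b, c ≠ ⊥ ∧
        ∃ F : Finset (CondSubset X), (F : Set (CondSubset X)) ⊆ S ∧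
          ∀ x, c ≤ F.sup fun Y => Y.truth x) : T.Compact := by
  intro J O hO hcov
  rw [univ_le_condUnion_iff] at hcov
  let D : Set A := {c | ∃ (m : ℕ+) (s : ℕ+ → J.sec ⊤), ∀ x,
    c ≤ ⨆ l, ⨆ _ : l ≤ m, (O.toFun ⊤ (s l)).1.truth x}
  have hD : ⨆ c : D, c.1 = ⊤ := by
    by_contra hn
    obtain ⟨c, hc, hc0, F, hF, hle⟩ := h (Set.range fun j => (O.toFun ⊤ j).1)
      (by rintro _ ⟨j, rfl⟩; exact hO j)
      (fun x => (iSup_range' (fun Y => truth Y x) fun j => (O.toFun ⊤ j).1).trans (hcov x))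
      (⨆ c : D, c.1)ᶜ (fun e => hn (compl_eq_bot.1 e))
    refine hc0 (disjoint_self.1 (disjoint_compl_right.mono ?_ hc))
    refine le_iSup (fun c : D => c.1) ⟨c, ?_⟩
    have := J.nonempty_sec ⊤
    obtain ⟨m, s, hs⟩ := exists_enumeration_of_subset_range F hF
    refine ⟨m, s, fun x => (hle x).trans (Finset.sup_le fun Y hY => ?_)⟩
    obtain ⟨l, hl, rfl⟩ := hs Y hY
    exact le_iSup₂_of_le l hl le_rfl
  obtain ⟨d, hd, hle⟩ := IsPartition.exists_le (fun c : D => c.1)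
  rw [hD] at hd
  choose m s hs using fun c : D => c.2
  -- Glue the finite families and their lengths along the partition `d`.
  choose t ht _ using fun l => J.stability d hd fun c => J.γ (d c) (s c l)
  obtain ⟨ψ, hψ⟩ := exists_natFun t
  let n : (nat A).sec ⊤ := ⟨_, hd.map m⟩
  refine ⟨n, ⟨fun a k => ψ.toFun a k.1, fun a k => ψ.map_γ a k.1⟩, ?_⟩
  rw [univ_le_condUnion_iff]
  refine fun x => top_le_iff.1 (hd.1.ge.trans (iSup_le fun c => ?_))
  refine (le_inf le_rfl ((hle c).trans (hs c x))).trans ?_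
  simp only [inf_iSup_eq]
  refine iSup₂_le fun l hl => ?_
  obtain ⟨k, hk⟩ := exists_upTo_min n l
  have hck : d c ≤ k.1.1 l := (IsPartition.le_map d m rfl).trans (hk (m c) hl)
  have e1 : J.γ (d c) (s c l) = J.γ (d c) (ψ.toFun ⊤ k.1) := by
    rw [← ht l c]
    exact (J.consistency _ _ _ _ hck (hψ k.1 l)).symm
  have e2 : X.powerset.γ (d c) (O.toFun ⊤ (s c l)) =
      X.powerset.γ (d c) (O.toFun ⊤ (ψ.toFun ⊤ k.1)) := by
    rw [← O.map_γ, e1, O.map_γ]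
  rw [inf_truth_eq_of_γ_eq e2]
  exact inf_le_right.trans
    (le_iSup (fun k : (upTo n).sec ⊤ => (O.toFun ⊤ (ψ.toFun ⊤ k.1)).1.truth x) k)

end CondTopology

/-! ### Maximal families without finite subcovers -/

namespace CondSubset

variable {A : Type u} [CompleteBooleanAlgebra A] {X : CondSet.{u, v} A}

/-- No finite subfamily of `M` covers `X` on a nonzero condition below `b`. Internally, `M`
generates a proper ideal of conditional subsets on `b`. -/
def NoFiniteSubcover (b : A) (M : Set (CondSubset X)) : Prop :=
  ∀ F : Finset (CondSubset X), (F : Set (CondSubset X)) ⊆ M →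
    ∀ c ≤ b, (∀ x, c ≤ F.sup fun Y => Y.truth x) → c = ⊥

theorem NoFiniteSubcover.exists_maximal {b : A} {S : Set (CondSubset X)}
    (hS : NoFiniteSubcover b S) : ∃ M, S ⊆ M ∧ Maximal (NoFiniteSubcover b) M := by
  have hfin : Order.IsOfFiniteCharacter {M : Set (CondSubset X) | NoFiniteSubcover b M} := by
    refine fun M => ⟨fun hM N hN _ F hF => hM F (hF.trans hN), fun h F hF => ?_⟩
    exact h F hF F.finite_toSet F subset_rfl
  exact hfin.exists_maximal hS

variable {b : A} {M : Set (CondSubset X)}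

theorem exists_cover_of_notMem (hM : Maximal (NoFiniteSubcover b) M) {Y : CondSubset X}
    (hY : Y ∉ M) : ∃ c ≤ b, c ≠ ⊥ ∧ ∃ F : Finset (CondSubset X), (F : Set (CondSubset X)) ⊆ M ∧
      ∀ x, c ≤ Y.truth x ⊔ F.sup fun Z => Z.truth x := by
  classical
  have h : ¬ NoFiniteSubcover b (insert Y M) := fun h =>
    hY (hM.2 h (Set.subset_insert Y M) (Set.mem_insert Y M))
  unfold NoFiniteSubcover at h
  push Not at h
  obtain ⟨F, hF, c, hc, hcov, hc0⟩ := h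
  refine ⟨c, hc, hc0, F.erase Y, fun Z hZ => ?_,
    fun x => (hcov x).trans (Finset.sup_le fun Z hZ => ?_)⟩
  · have hZ' := Finset.mem_erase.1 hZ
    exact (hF hZ'.2).resolve_left hZ'.1
  · by_cases e : Z = Y
    · exact e ▸ le_sup_left
    · exact le_sup_of_le_right
        (Finset.le_sup (f := fun Z => truth Z x) (Finset.mem_erase.2 ⟨e, hZ⟩))

/-- The ideal generated by a maximal family is prime: if the intersection of a finite family `G`
lies in a member of `M` on a nonzero condition `a`, then on some nonzero condition below `a` one of
the sets in `G` belongs to `M`. -/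
theorem exists_restrict_mem (hM : Maximal (NoFiniteSubcover b) M) {O : CondSubset X} (hO : O ∈ M)
    {a : A} (hab : a ≤ b) (ha0 : a ≠ ⊥) (G : Finset (CondSubset X))
    (hG : ∀ x, a ⊓ G.inf (fun Y => Y.truth x) ≤ O.truth x) :
    ∃ c ≤ a, c ≠ ⊥ ∧ ∃ Y ∈ G, restrict c Y ∈ M := by
  classical
  by_contra! hn
  -- Otherwise members of `M` cover the complement of the intersection on a smaller condition.
  have key : ∃ c ≤ a, c ≠ ⊥ ∧ ∃ F : Finset (CondSubset X), (F : Set (CondSubset X)) ⊆ M ∧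
      ∀ x, c ≤ G.inf (fun Y => Y.truth x) ⊔ F.sup fun Y => Y.truth x := by
    clear hG
    induction G using Finset.induction_on with
    | empty => exact ⟨a, le_rfl, ha0, ∅, by simp, by simp⟩
    | insert Y G _ ih =>
      obtain ⟨c, hc, hc0, F, hF, hcov⟩ :=
        ih fun c hc hc0 Z hZ => hn c hc hc0 Z (Finset.mem_insert_of_mem hZ)
      obtain ⟨d, hd, hd0, F', hF', hcov'⟩ :=
        exists_cover_of_notMem hM (hn c hc hc0 Y (Finset.mem_insert_self Y G))
      simp only [truth_restrict] at hcov'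
      refine ⟨c ⊓ d, inf_le_left.trans hc, fun h0 => hd0 (hM.1 F' hF' d hd fun x => ?_), F ∪ F',
        by simp [hF, hF'], fun x => ?_⟩
      · -- If `d` misses `c`, the restriction of `Y` to `c` contributes nothing on `d`.
        have h1 := le_inf (hcov' x) (le_refl d)
        rw [inf_sup_right, inf_right_comm, h0, bot_inf_eq, bot_sup_eq] at h1
        exact h1.trans inf_le_left
      · rw [Finset.inf_insert, Finset.sup_union, sup_inf_right]
        refine le_inf (inf_le_right.trans ((hcov' x).trans ?_))
          (inf_le_left.trans ((hcov x).trans ?_))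
        · exact sup_le_sup inf_le_right le_sup_right
        · exact sup_le_sup_left le_sup_left _
  obtain ⟨c, hc, hc0, F, hF, hcov⟩ := key
  refine hc0 (hM.1 (insert O F) ?_ c (hc.trans hab) fun x => ?_)
  · simpa [Set.insert_subset_iff] using ⟨hO, hF⟩
  · rw [Finset.sup_insert, ← inf_eq_left.2 (hcov x), inf_sup_left]
    exact sup_le_sup ((inf_le_inf_right _ hc).trans (hG x)) inf_le_right

end CondSubset

/-! ### Conditional products -/

namespace CondTopology

open CondSubset CondSet

variable {A : Type u} [CompleteBooleanAlgebra A] {I : Type w} {X : I → CondSet.{u, v} A}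
  {T : ∀ i, CondTopology (X i)}

theorem preimage_proj_mem_product {i : I} {O : CondSubset (X i)} (hO : O.MemSystem (T i).opens) :
    ((CondFun.proj X i).preimage O).MemSystem (product T).opens :=
  le_generate _ ⊤ (subset_stableHull _ ⟨i, O, hO, rfl⟩)

theorem truth_preimage_proj (i : I) (O : CondSubset (X i)) (x : (CondSet.prod X).sec ⊤) :
    ((CondFun.proj X i).preimage O).truth x = O.truth (x i) :=
  truth_preimage _ _ _

/-- A finite family of cylinders over `X i` covers the product where their bases cover `X i`. -/
theorem exists_finset_base {i : I} {S : Set (CondSubset (X i))}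
    {F : Finset (CondSubset (CondSet.prod X))}
    (hF : (F : Set (CondSubset (CondSet.prod X))) ⊆ (CondFun.proj X i).preimage '' S) :
    ∃ F' : Finset (CondSubset (X i)), (F' : Set (CondSubset (X i))) ⊆ S ∧
      ∀ x, F.sup (fun Y => Y.truth x) = F'.sup fun Y => Y.truth (x i) := by
  classical
  obtain ⟨F', hF', rfl⟩ := Finset.subset_set_image_iff.1 hF
  refine ⟨F', hF', fun x => ?_⟩
  rw [Finset.sup_image]
  exact Finset.sup_congr rfl fun Y _ => truth_preimage_proj i Y x

theorem Compact.of_product (h : (product T).Compact) (i : I) : (T i).Compact := by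
  classical
  refine compact_of_exists_finset fun S hS hcov b hb => ?_
  obtain ⟨c, hc, hc0, F, hF, hle⟩ := h.exists_finset (S := (CondFun.proj X i).preimage '' S)
    (by rintro _ ⟨O, hO, rfl⟩; exact preimage_proj_mem_product (hS O hO))
    (fun x => by
      refine top_le_iff.1 ((hcov (x i)).ge.trans (iSup_le fun Y => ?_))
      rw [← truth_preimage_proj i Y.1 x]
      exact le_iSup (fun Z : (CondFun.proj X i).preimage '' S => Z.1.truth x)
        ⟨_, Y.1, Y.2, rfl⟩) hb
  obtain ⟨F', hF', hsup⟩ := exists_finset_base hF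
  refine ⟨c, hc, hc0, F', hF', fun y => ?_⟩
  let x : (CondSet.prod X).sec ⊤ := fun j => ((X j).nonempty_sec ⊤).some
  have := (hle (Function.update x i y)).trans_eq (hsup _)
  rwa [Function.update_self] at this

/-- The open bases of those cylinders over a compact `X i` that belong to a family without finite
subcovers all leave out one common point of `X i` on all of `b`. -/
theorem exists_coordinate {i : I} (hT : (T i).Compact) {b : A}
    {M : Set (CondSubset (CondSet.prod X))} (hM : NoFiniteSubcover b M) :
    ∃ y : (X i).sec ⊤, ∀ O : CondSubset (X i), O.MemSystem (T i).opens →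
      (CondFun.proj X i).preimage O ∈ M → b ⊓ O.truth y = ⊥ := by
  classical
  let S : Set (CondSubset (X i)) :=
    {O | O.MemSystem (T i).opens ∧ (CondFun.proj X i).preimage O ∈ M}
  obtain ⟨y, hy⟩ := exists_inf_truth_eq_bot (condUnion fun O : S => O.1) (b := b) (by
    intro c hc hcov
    by_contra hc0
    simp only [truth_condUnion] at hcov
    -- Adding the part of the space off `c` turns a cover on `c` into a cover on `⊤`.
    let R : CondSubset (X i) := restrict cᶜ (univ (X i))
    obtain ⟨d, hd, hd0, F, hF, hle⟩ := hT.exists_finset (S := insert R S)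
      (by
        rintro O (rfl | hO)
        exacts [restrict_mem _ (T i).univ_mem _, hO.1])
      (fun x => by
        refine top_le_iff.1 (sup_compl_eq_top.ge.trans (sup_le ((hcov x).trans ?_) ?_ : c ⊔ cᶜ ≤ _))
        · exact iSup_le fun O => le_iSup (fun Y : (insert R S : Set _) => Y.1.truth x)
            ⟨O.1, Or.inr O.2⟩
        · refine le_trans ?_ (le_iSup (fun Y : (insert R S : Set _) => Y.1.truth x)
            ⟨R, Or.inl rfl⟩)
          simp [R]) hc0
    refine hd0 (hM ((F.erase R).image (CondFun.proj X i).preimage) ?_ d (hd.trans hc) fun x => ?_)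
    · intro Z hZ
      obtain ⟨O, hO, rfl⟩ := Finset.mem_image.1 hZ
      have hO' := Finset.mem_erase.1 hO
      exact ((hF hO'.2).resolve_left hO'.1).2
    · have h1 : d ≤ cᶜ ⊔ (F.erase R).sup fun O => O.truth (x i) := by
        refine (hle (x i)).trans (Finset.sup_le fun O hO => ?_)
        by_cases e : O = R
        · subst e
          simp [R]
        · exact le_sup_of_le_right
            (Finset.le_sup (f := fun O => truth O (x i)) (Finset.mem_erase.2 ⟨e, hO⟩))
      rw [Finset.sup_image]
      refine ((le_inf le_rfl h1).trans (inf_sup_left _ _ _).le).trans (sup_le ?_ ?_)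
      · exact ((inf_le_inf_right _ hd).trans (inf_compl_eq_bot (a := c)).le).trans bot_le
      · refine inf_le_right.trans (Finset.sup_mono_fun fun O _ => ?_)
        exact (truth_preimage_proj i O x).ge)
  refine ⟨y, fun O hO hOM => le_bot_iff.1 (le_trans (inf_le_inf_left _ ?_) hy.le)⟩
  rw [truth_condUnion]
  exact le_iSup (fun O : S => O.1.truth y) ⟨O, hO, hOM⟩

theorem Compact.product (hT : ∀ i, (T i).Compact) : (product T).Compact := by
  refine compact_of_exists_finset fun S hS hcov b hb => ?_
  by_contra! hn
  have hS0 : NoFiniteSubcover b S := by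
    intro F hF c hc hcov
    by_contra hc0
    obtain ⟨x, hx⟩ := hn c hc hc0 F hF
    exact hx (hcov x)
  obtain ⟨M, hSM, hM⟩ := hS0.exists_maximal
  choose x hx using fun i => exists_coordinate (hT i) hM.1
  have : ∃ O : S, b ⊓ O.1.truth x ≠ ⊥ := by
    by_contra! h0
    refine hb ?_
    rw [← inf_top_eq b, ← hcov x, inf_iSup_eq]
    simp [h0]
  obtain ⟨O, hO⟩ := this
  obtain ⟨c, hc, hc0, F, hF, h1, h2⟩ :=
    locallyGenerated_of_mem_generate (hS O.1 O.2) x _ inf_le_right hO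
  obtain ⟨d, hd, hd0, Y, hY, hYM⟩ :=
    exists_restrict_mem hM (hSM O.2) (hc.trans inf_le_left) hc0 F h2
  obtain ⟨i, V, hV, rfl⟩ := hF Y hY
  -- Restriction commutes with preimages, so the restricted base is one of the sets avoided by `x`.
  have e : restrict d ((CondFun.proj X i).preimage V) =
      (CondFun.proj X i).preimage (restrict d V) :=
    ext_truth fun z => by simp
  have hdV : d ≤ V.truth (x i) := by
    rw [← truth_preimage_proj i V x]
    exact hd.trans (h1.trans (Finset.inf_le hY))
  have := hx i (restrict d V) ((T i).restrict_mem hV d) (e ▸ hYM)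
  rw [truth_restrict, inf_eq_left.2 hdV,
    inf_eq_right.2 (hd.trans (hc.trans inf_le_left))] at this
  exact hd0 this

end CondTopology

theorem mainTheorem3 {A : Type u} [CompleteBooleanAlgebra A] [Nontrivial A]
    {I : Type w} [Nonempty I] (X : I → CondSet.{u, v} A) (T : ∀ i, CondTopology (X i)) :
    (CondTopology.product T).Compact ↔ ∀ i, (T i).Compact :=
  ⟨CondTopology.Compact.of_product, CondTopology.Compact.product⟩
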